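/- Let $\mathcal H$ be a finite-dimensional complex Hilbert space with orthonormal basis $\{|i\rangle\}_i$, and let $X,Y$ be positive definite operators on $\mathcal H$. Put $|\Gamma\rangle=\sum_i|i\rangle\otimes|i\rangle$ and $|\varphi^X\rangle=(X^{1/2}\otimes I)|\Gamma\rangle\in\mathcal H\otimes\mathcal H$, and let ${}^T$ denote the transpose with respect to $\{|i\rangle\}_i$. For $f:(0,\infty)\to\mathbb R$, the optimized quantum $f$-divergence is $$\widetilde Q_f(X\Vert Y)=\sup_{\tau>0,\ \operatorname{Tr}\tau\le 1}\langle\varphi^X|\,f(\tau^{-1}\otimes Y^T)\,|\varphi^X\rangle ,$$ the supremum being over positive definite operators $\tau$ on $\mathcal H$. For positive semidefinite $Z$ put $\|Z\|_\alpha=[\operatorname{Tr}(Z^\alpha)]^{1/\alpha}$ for $0<\alpha<\infty$, and let $\|Z\|_\infty$ be the operator norm. Then the following hold, where the right-hand sides are, up to sign, the sandwiched Rényi relative quasi-entropies. 1. For every $\alpha\in[1/2,1)$ and $f(x)=-x^{(1-\alpha)/\alpha}$, $$\widetilde Q_{f}(X\Vert Y)=-\left\Vert Y^{(1-\alpha)/2\alpha}\,X\,Y^{(1-\alpha)/2\alpha}\right\Vert_\alpha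 .$$ 2. For every $\alpha\in(1,\infty]$ and $f(x)=x^{(1-\alpha)/\alpha}$, $$\widetilde Q_{f}(X\Vert Y)=\left\Vert Y^{(1-\alpha)/2\alpha}\,X\,Y^{(1-\alpha)/2\alpha}\right\Vert_\alpha ,$$ where for $\alpha=\infty$ the exponents $(1-\alpha)/\alpha$ and $(1-\alpha)/2\alpha$ are read as their limits $-1$ and $-1/2$. -/

import Mathlib

open scoped Kronecker ComplexOrder

namespace OptimizedDivergence

noncomputable section

variable {n : Type*} [Fintype n] [DecidableEq n]

/-- The real power `A ^ s` of a positive definite (or, for `0 < s`, positive semidefinite) matrix,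
by the spectral functional calculus. The spectrum is finite, so that no continuity is at issue. -/
def mpow (A : Matrix n n ℂ) (s : ℝ) : Matrix n n ℂ :=
  cfc (fun x : ℝ => x ^ s) A

/-- The unnormalized maximally entangled vector `∑ i, |i⟩ ⊗ |i⟩`, in coordinates. -/
def maxEntangled (n : Type*) [DecidableEq n] : n × n → ℂ :=
  fun p => if p.1 = p.2 then 1 else 0

/-- The vector `(X ^ (1 / 2) ⊗ I) |Γ⟩`. -/
def phi (X : Matrix n n ℂ) : n × n → ℂ :=
  (mpow X (1 / 2) ⊗ₖ (1 : Matrix n n ℂ)).mulVec (maxEntangled n)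

/-- `⟨φ^X| f(τ⁻¹ ⊗ Yᵀ) |φ^X⟩`, for positive definite `X`, `Y`, `τ`. The spectrum of `τ⁻¹ ⊗ Yᵀ` is a
finite subset of `(0, ∞)`, so that only the values of `f` on `(0, ∞)` matter; the operator
`f(τ⁻¹ ⊗ Yᵀ)` is Hermitian, so that the expectation is real. -/
def divergenceAt (f : ℝ → ℝ) (X Y τ : Matrix n n ℂ) : ℝ :=
  (star (phi X) ⬝ᵥ (cfc f (τ⁻¹ ⊗ₖ Y.transpose)).mulVec (phi X)).re

/-- The optimized quantum `f`-divergence: the supremum, in the extended reals, over all positive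
definite `τ` with `Tr τ ≤ 1`. -/
def optimizedDivergence (f : ℝ → ℝ) (X Y : Matrix n n ℂ) : EReal :=
  ⨆ (τ : Matrix n n ℂ) (_ : τ.PosDef ∧ τ.trace.re ≤ 1), ((divergenceAt f X Y τ : ℝ) : EReal)

/-- `‖Z‖_α = (Tr (Z ^ α)) ^ (1 / α)`, for positive semidefinite `Z` and `0 < α < ∞`. -/
def schatten (α : ℝ) (Z : Matrix n n ℂ) : ℝ :=
  (mpow Z α).trace.re ^ (1 / α)

/-- `‖Z‖_∞`: the operator norm of `Z` on the Euclidean space `ℂⁿ`. -/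
def schattenTop (Z : Matrix n n ℂ) : ℝ :=
  ‖Matrix.toEuclideanCLM (n := n) (𝕜 := ℂ) Z‖

end

end OptimizedDivergence

/-! Put `s = (1 - α) / α`. Powers are multiplicative, so `(τ⁻¹ ⊗ Yᵀ) ^ s = τ ^ (-s) ⊗ (Y ^ s)ᵀ`, and
its expectation in `φ^X` is `Tr (τ ^ (-s) A)` with `A = X ^ (1/2) Y ^ s X ^ (1/2)`
(`divergenceAt_rpow`). Optimizing over `τ` is then the variational formula for `‖A‖_α`: Hölder
bounds the trace above for `α > 1`, reverse Hölder bounds it below for `α < 1`, and `τ = A ^ α / Tr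
(A ^ α)` gives equality. For `α = ∞` the supremum is approached by states concentrating on a top
eigenvector of `A`.

Both trace inequalities become scalar ones: in eigenbases of `τ` and `A` the trace is a sum weighted
by the squared overlaps, a doubly stochastic matrix whose marginals return `Tr τ` and `Tr (A ^ α)`.

Finally `A = B B⋆` and `Y ^ (s/2) X Y ^ (s/2) = B⋆ B` have the same characteristic polynomial, hence
the same norms (`charpoly_sandwich`). -/

namespace OptimizedDivergence

open Matrix

/-! ### Functional calculus in unitary diagonalizations -/

section Diagonalization

variable {n m : Type*} [Fintype n] [DecidableEq n] [Fintype m] [DecidableEq m]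

/-- The Hermitian matrix `U * diag d * U⋆`. -/
noncomputable def conjDiag (U : Matrix n n ℂ) (d : n → ℝ) : Matrix n n ℂ :=
  U * diagonal (fun i => (d i : ℂ)) * star U

lemma isHermitian_conjDiag (U : Matrix n n ℂ) (d : n → ℝ) : (conjDiag U d).IsHermitian := by
  unfold conjDiag
  simp only [IsHermitian, star_eq_conjTranspose, conjTranspose_mul, conjTranspose_conjTranspose,
    diagonal_conjTranspose, Matrix.mul_assoc]
  congr 3
  ext i
  simp

lemma conjDiag_mul {U : Matrix n n ℂ} (hU : star U * U = 1) (d e : n → ℝ) :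
    conjDiag U d * conjDiag U e = conjDiag U (fun i => d i * e i) := by
  have : conjDiag U d * conjDiag U e =
      U * diagonal (fun i => (d i : ℂ)) * (star U * U) * diagonal (fun i => (e i : ℂ)) *
        star U := by
    simp only [conjDiag, Matrix.mul_assoc]
  rw [this, hU, Matrix.mul_one, conjDiag, Matrix.mul_assoc U, diagonal_mul_diagonal]
  simp

lemma conjDiag_one {U : Matrix n n ℂ} (hU : star U * U = 1) :
    conjDiag U (fun _ => 1) = 1 := by
  simp [conjDiag, mul_eq_one_comm.mp hU]

lemma conjDiag_add (U : Matrix n n ℂ) (d e : n → ℝ) :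
    conjDiag U d + conjDiag U e = conjDiag U (fun i => d i + e i) := by
  simp only [conjDiag, ← Matrix.add_mul, ← Matrix.mul_add, diagonal_add, Complex.ofReal_add]

lemma conjDiag_inv {U : Matrix n n ℂ} (hU : star U * U = 1) {d : n → ℝ} (hd : ∀ i, 0 < d i) :
    (conjDiag U d)⁻¹ = conjDiag U (fun i => (d i)⁻¹) := by
  apply Matrix.inv_eq_right_inv
  rw [conjDiag_mul hU, ← conjDiag_one hU]
  congr 1
  ext i
  exact mul_inv_cancel₀ (hd i).ne'

lemma aeval_conjDiag {U : Matrix n n ℂ} (hU : star U * U = 1) (d : n → ℝ)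
    (q : Polynomial ℝ) :
    Polynomial.aeval (conjDiag U d) q = conjDiag U (fun i => q.eval (d i)) := by
  induction q using Polynomial.induction_on with
  | C r =>
    simp only [Polynomial.aeval_C, Polynomial.eval_C]
    have h : conjDiag U (fun _ => r) = (r : ℂ) • conjDiag U (fun _ => 1) := by
      simp only [conjDiag, Complex.ofReal_one]
      rw [← Matrix.smul_mul, ← Matrix.mul_smul, ← diagonal_smul]
      congr 3
      ext i
      simp
    rw [h, conjDiag_one hU, Algebra.algebraMap_eq_smul_one]
    ext i j
    simp [Matrix.one_apply]
  | add p q hp hq => simp only [map_add, hp, hq, conjDiag_add, Polynomial.eval_add]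
  | monomial k r h =>
    have : Polynomial.C r * Polynomial.X ^ (k + 1) =
        Polynomial.C r * Polynomial.X ^ k * (Polynomial.X : Polynomial ℝ) := by
      rw [pow_succ, mul_assoc]
    rw [this, map_mul, h, Polynomial.aeval_X, conjDiag_mul hU]
    simp

/-- The functional calculus acts on the diagonal of any unitary diagonalization. -/
lemma cfc_conjDiag {U : Matrix n n ℂ} (hU : star U * U = 1) (d : n → ℝ) (f : ℝ → ℝ) :
    cfc f (conjDiag U d) = conjDiag U (fun i => f (d i)) := by
  have hA := isHermitian_conjDiag U d
  classical
  -- Nodes on both the spectrum and the entries of `d`: one polynomial then agrees with `f` on both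
  -- sides, and the two sets need not be compared.
  let s : Finset ℝ := (finite_real_spectrum (A := conjDiag U d)).toFinset ∪ Finset.univ.image d
  have hq : ∀ x ∈ s, (Lagrange.interpolate s id f).eval x = f x := fun x hx =>
    Lagrange.eval_interpolate_at_node (v := id) f Function.injective_id.injOn hx
  have h1 : cfc f (conjDiag U d) =
      cfc (Lagrange.interpolate s id f).eval (conjDiag U d) :=
    cfc_congr fun x hx => (hq x (by simp [s, hx])).symm
  rw [h1, cfc_polynomial _ _ hA.isSelfAdjoint, aeval_conjDiag hU]
  congr 1
  ext i
  exact hq _ (by simp [s])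

lemma mpow_conjDiag {U : Matrix n n ℂ} (hU : star U * U = 1) (d : n → ℝ) (s : ℝ) :
    mpow (conjDiag U d) s = conjDiag U (fun i => d i ^ s) :=
  cfc_conjDiag hU d _

lemma exists_conjDiag {A : Matrix n n ℂ} (hA : A.PosDef) :
    ∃ U : Matrix n n ℂ, star U * U = 1 ∧ ∃ d : n → ℝ, (∀ i, 0 < d i) ∧ A = conjDiag U d := by
  refine ⟨hA.1.eigenvectorUnitary, by simp, hA.1.eigenvalues, hA.eigenvalues_pos, ?_⟩
  conv_lhs => rw [hA.1.spectral_theorem, Unitary.conjStarAlgAut_apply]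
  rfl

lemma posDef_conjDiag {U : Matrix n n ℂ} (hU : star U * U = 1) {d : n → ℝ}
    (hd : ∀ i, 0 < d i) : (conjDiag U d).PosDef := by
  have hu : IsUnit U := IsUnit.of_mul_eq_one _ (mul_eq_one_comm.mp hU)
  rw [conjDiag, hu.posDef_star_right_conjugate_iff, posDef_diagonal_iff]
  exact fun i => by exact_mod_cast hd i

lemma trace_conjDiag {U : Matrix n n ℂ} (hU : star U * U = 1) (d : n → ℝ) :
    (conjDiag U d).trace.re = ∑ i, d i := by
  rw [conjDiag, trace_mul_comm, ← Matrix.mul_assoc, hU, Matrix.one_mul, trace_diagonal]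
  simp

lemma kronecker_conjDiag (U : Matrix n n ℂ) (V : Matrix m m ℂ) (d : n → ℝ) (e : m → ℝ) :
    conjDiag U d ⊗ₖ conjDiag V e = conjDiag (U ⊗ₖ V) (fun p => d p.1 * e p.2) := by
  simp only [conjDiag, mul_kronecker_mul, diagonal_kronecker_diagonal, star_eq_conjTranspose,
    conjTranspose_kronecker, Complex.ofReal_mul]

/-- `(star U)ᵀ` is the entrywise conjugate of `U`; the diagonal is kept, so powers commute with
transposition. -/
lemma transpose_conjDiag (U : Matrix n n ℂ) (d : n → ℝ) :
    (conjDiag U d)ᵀ = conjDiag (star U)ᵀ d := by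
  have h : star (star U)ᵀ = Uᵀ := by
    ext i j
    simp [star_apply]
  simp only [conjDiag, transpose_mul, diagonal_transpose, Matrix.mul_assoc, h]

lemma star_mul_self_transpose_star {U : Matrix n n ℂ} (hU : star U * U = 1) :
    star (star U)ᵀ * (star U)ᵀ = 1 := by
  have h : star (star U)ᵀ = Uᵀ := by
    ext i j
    simp [star_apply]
  rw [h, ← transpose_mul, hU, transpose_one]

lemma star_mul_self_kronecker {U : Matrix n n ℂ} {V : Matrix m m ℂ} (hU : star U * U = 1)
    (hV : star V * V = 1) : star (U ⊗ₖ V) * (U ⊗ₖ V) = 1 := by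
  rw [star_eq_conjTranspose] at *
  rw [conjTranspose_kronecker, ← mul_kronecker_mul, hU, hV, one_kronecker_one]

end Diagonalization

/-! ### Powers of positive definite matrices -/

section Powers

variable {n : Type*} [Fintype n] [DecidableEq n]

lemma posDef_mpow {A : Matrix n n ℂ} (hA : A.PosDef) (s : ℝ) : (mpow A s).PosDef := by
  obtain ⟨U, hU, d, hd, rfl⟩ := exists_conjDiag hA
  rw [mpow_conjDiag hU]
  exact posDef_conjDiag hU fun i => Real.rpow_pos_of_pos (hd i) s

lemma mpow_mul_mpow {A : Matrix n n ℂ} (hA : A.PosDef) (s t : ℝ) :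
    mpow A s * mpow A t = mpow A (s + t) := by
  obtain ⟨U, hU, d, hd, rfl⟩ := exists_conjDiag hA
  simp only [mpow_conjDiag hU, conjDiag_mul hU, Real.rpow_add (hd _)]

lemma mpow_one {A : Matrix n n ℂ} (hA : A.PosDef) : mpow A 1 = A := by
  obtain ⟨U, hU, d, hd, rfl⟩ := exists_conjDiag hA
  simp only [mpow_conjDiag hU, Real.rpow_one]

/-- On eigenvalues this is `(t⁻¹ y) ^ s = t ^ (-s) y ^ s`, the property that singles out power
functions. -/
lemma cfc_rpow_inv_kronecker_transpose {T Y : Matrix n n ℂ} (hT : T.PosDef) (hY : Y.PosDef)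
    (s : ℝ) :
    cfc (fun x : ℝ => x ^ s) (T⁻¹ ⊗ₖ Yᵀ) = mpow T (-s) ⊗ₖ (mpow Y s)ᵀ := by
  obtain ⟨U, hU, t, ht, rfl⟩ := exists_conjDiag hT
  obtain ⟨V, hV, y, hy, rfl⟩ := exists_conjDiag hY
  rw [conjDiag_inv hU ht, transpose_conjDiag, kronecker_conjDiag,
    cfc_conjDiag (star_mul_self_kronecker hU (star_mul_self_transpose_star hV)),
    mpow_conjDiag hU, mpow_conjDiag hV, transpose_conjDiag, kronecker_conjDiag]
  congr 1
  ext p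
  rw [Real.mul_rpow (inv_pos.2 (ht _)).le (hy _).le, Real.inv_rpow (ht _).le,
    Real.rpow_neg (ht _).le]

/-- The trace of `g(A)` depends on the Hermitian matrix `A` only through its characteristic
polynomial. -/
lemma trace_cfc_eq_of_charpoly_eq {A B : Matrix n n ℂ} (hA : A.IsHermitian)
    (hB : B.IsHermitian) (h : A.charpoly = B.charpoly) (g : ℝ → ℝ) :
    (cfc g A).trace.re = (cfc g B).trace.re := by
  have key : ∀ {C : Matrix n n ℂ} (hC : C.IsHermitian),
      (cfc g C).trace.re = (C.charpoly.roots.map fun z => g z.re).sum := by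
    intro C hC
    have hC' : cfc g C = conjDiag hC.eigenvectorUnitary (fun i => g (hC.eigenvalues i)) := by
      rw [hC.cfc_eq, IsHermitian.cfc, Unitary.conjStarAlgAut_apply]
      rfl
    rw [hC', trace_conjDiag (by simp), hC.roots_charpoly_eq_eigenvalues, Multiset.map_map]
    simp
  rw [key hA, key hB, h]

end Powers

/-! ### The divergence as a trace -/

section Divergence

variable {n : Type*} [Fintype n] [DecidableEq n]

lemma phi_eq_vec (X : Matrix n n ℂ) : phi X = vec (mpow X (1 / 2))ᵀ := by
  have h : maxEntangled n = vec (1 : Matrix n n ℂ) := by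
    ext p
    simp [maxEntangled, vec, Matrix.one_apply, eq_comm]
  rw [phi, h, kronecker_mulVec_vec]
  simp

/-- Since `phi X` is a vectorized matrix, the Kronecker product acts on it by left and right
multiplication, and the inner product is a trace. -/
lemma dotProduct_phi {X : Matrix n n ℂ} (hX : X.PosDef) (P S : Matrix n n ℂ) :
    star (phi X) ⬝ᵥ (P ⊗ₖ Sᵀ).mulVec (phi X) =
      (P * (mpow X (1 / 2) * S * mpow X (1 / 2))).trace := by
  have hR := (posDef_mpow hX (1 / 2)).1
  rw [phi_eq_vec, kronecker_mulVec_vec, star_vec_dotProduct_vec]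
  have h : ((mpow X (1 / 2))ᵀ)ᴴ = (mpow X (1 / 2))ᵀ := by
    exact hR.transpose.eq
  rw [h, ← trace_transpose]
  simp only [transpose_mul, transpose_transpose, Matrix.mul_assoc]

lemma divergenceAt_rpow {X Y T : Matrix n n ℂ} (hX : X.PosDef) (hY : Y.PosDef) (hT : T.PosDef)
    (s : ℝ) :
    divergenceAt (fun x : ℝ => x ^ s) X Y T =
      (mpow T (-s) * (mpow X (1 / 2) * mpow Y s * mpow X (1 / 2))).trace.re := by
  rw [divergenceAt, cfc_rpow_inv_kronecker_transpose hT hY, dotProduct_phi hX]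

lemma divergenceAt_neg (f : ℝ → ℝ) (X Y T : Matrix n n ℂ) :
    divergenceAt (fun x => -f x) X Y T = -divergenceAt f X Y T := by
  simp only [divergenceAt, cfc_neg, Matrix.neg_mulVec, dotProduct_neg, Complex.neg_re]

end Divergence

/-! ### Doubly stochastic overlaps of eigenbases -/

section Overlap

variable {n : Type*} [Fintype n]

/-- The squared overlaps of two orthonormal bases. -/
noncomputable def overlap (U V : Matrix n n ℂ) (i j : n) : ℝ :=
  Complex.normSq ((star U * V) i j)

lemma overlap_nonneg (U V : Matrix n n ℂ) (i j : n) : 0 ≤ overlap U V i j :=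
  Complex.normSq_nonneg _

lemma sum_normSq_row [DecidableEq n] {W : Matrix n n ℂ} (hW : W * star W = 1) (i : n) :
    ∑ j, Complex.normSq (W i j) = 1 := by
  have h := congrFun (congrFun hW i) i
  rw [Matrix.mul_apply, Matrix.one_apply_eq] at h
  apply Complex.ofReal_injective
  rw [← Complex.ofReal_one] at h
  rw [← h]
  simp [star_apply, Complex.mul_conj]

lemma sum_overlap_right [DecidableEq n] {U V : Matrix n n ℂ} (hU : star U * U = 1) (hV : star V * V = 1)
    (i : n) : ∑ j, overlap U V i j = 1 := by
  apply sum_normSq_row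
  rw [star_mul, star_star, Matrix.mul_assoc, ← Matrix.mul_assoc V, mul_eq_one_comm.mp hV,
    Matrix.one_mul, hU]

lemma overlap_comm (U V : Matrix n n ℂ) (i j : n) : overlap U V i j = overlap V U j i := by
  have h : star (star U * V) = star V * U := by rw [star_mul, star_star]
  rw [overlap, overlap, ← h, star_apply]
  exact (Complex.normSq_conj _).symm

lemma sum_overlap_left [DecidableEq n] {U V : Matrix n n ℂ} (hU : star U * U = 1) (hV : star V * V = 1)
    (j : n) : ∑ i, overlap U V i j = 1 := by
  simp only [overlap_comm U V]
  exact sum_overlap_right hV hU j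

/-- With `W = star U * V`, cyclicity turns the trace into `Tr (D W E W⋆)`, whose expansion has only
the weights `|W i j| ^ 2`. -/
lemma trace_conjDiag_mul_conjDiag [DecidableEq n] (U V : Matrix n n ℂ) (d e : n → ℝ) :
    (conjDiag U d * conjDiag V e).trace.re =
      ∑ p : n × n, overlap U V p.1 p.2 * (d p.1 * e p.2) := by
  have h : (conjDiag U d * conjDiag V e).trace =
      (diagonal (fun i => (d i : ℂ)) * (star U * V) *
        (diagonal (fun i => (e i : ℂ)) * star (star U * V))).trace := by
    simp only [conjDiag, star_mul, star_star, Matrix.mul_assoc]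
    rw [trace_mul_comm]
    simp only [Matrix.mul_assoc]
  rw [h, trace, Complex.re_sum, Fintype.sum_prod_type]
  refine Finset.sum_congr rfl fun i _ => ?_
  rw [diag_apply, Matrix.mul_apply, Complex.re_sum]
  refine Finset.sum_congr rfl fun j _ => ?_
  rw [diagonal_mul, diagonal_mul, star_apply, overlap]
  have : (d i : ℂ) * (star U * V) i j * ((e j : ℂ) * star ((star U * V) i j)) =
      ((Complex.normSq ((star U * V) i j) * (d i * e j) : ℝ) : ℂ) := by
    push_cast
    rw [← Complex.mul_conj, ← starRingEnd_apply]
    ring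
  rw [this, Complex.ofReal_re]

lemma sum_overlap_mul_left [DecidableEq n] {U V : Matrix n n ℂ} (hU : star U * U = 1) (hV : star V * V = 1)
    (d : n → ℝ) : ∑ p : n × n, overlap U V p.1 p.2 * d p.1 = ∑ i, d i := by
  rw [Fintype.sum_prod_type]
  refine Finset.sum_congr rfl fun i _ => ?_
  dsimp only
  rw [← Finset.sum_mul, sum_overlap_right hU hV, one_mul]

lemma sum_overlap_mul_right [DecidableEq n] {U V : Matrix n n ℂ} (hU : star U * U = 1) (hV : star V * V = 1)
    (e : n → ℝ) : ∑ p : n × n, overlap U V p.1 p.2 * e p.2 = ∑ i, e i := by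
  rw [Fintype.sum_prod_type_right]
  refine Finset.sum_congr rfl fun i _ => ?_
  dsimp only
  rw [← Finset.sum_mul, sum_overlap_left hU hV, one_mul]

end Overlap

/-! ### Weighted scalar Hölder inequality -/

section Holder

/-- Hölder's inequality with weights `w` and exponents `1 / θ`, `1 / (1 - θ)`. -/
lemma sum_weight_mul_rpow_le {ι : Type*} (s : Finset ι) {w x y : ι → ℝ}
    (hw : ∀ i, 0 ≤ w i) (hx : ∀ i, 0 ≤ x i) (hy : ∀ i, 0 ≤ y i) {θ : ℝ} (h0 : 0 < θ)
    (h1 : θ < 1) :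
    ∑ i ∈ s, w i * (x i ^ θ * y i ^ (1 - θ)) ≤
      (∑ i ∈ s, w i * x i) ^ θ * (∑ i ∈ s, w i * y i) ^ (1 - θ) := by
  have h1' : 0 < 1 - θ := sub_pos.2 h1
  have hpq : Real.HolderConjugate (1 / θ) (1 / (1 - θ)) := by
    rw [Real.holderConjugate_iff]
    refine ⟨by rw [lt_div_iff₀ h0]; linarith, by simp⟩
  -- The weight is shared between the factors as `w = w ^ θ * w ^ (1 - θ)`, valid also at `w = 0`
  -- because the exponents sum to `1`.
  have h := Real.inner_le_Lp_mul_Lq_of_nonneg s hpq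
    (f := fun i => (w i * x i) ^ θ) (g := fun i => (w i * y i) ^ (1 - θ))
    (fun i _ => Real.rpow_nonneg (mul_nonneg (hw i) (hx i)) _)
    (fun i _ => Real.rpow_nonneg (mul_nonneg (hw i) (hy i)) _)
  have e1 : ∀ i, ((w i * x i) ^ θ) ^ (1 / θ) = w i * x i := fun i => by
    rw [← Real.rpow_mul (mul_nonneg (hw i) (hx i)), mul_one_div_cancel h0.ne', Real.rpow_one]
  have e2 : ∀ i, ((w i * y i) ^ (1 - θ)) ^ (1 / (1 - θ)) = w i * y i := fun i => by
    rw [← Real.rpow_mul (mul_nonneg (hw i) (hy i)), mul_one_div_cancel h1'.ne', Real.rpow_one]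
  simp only [e1, e2, one_div_one_div] at h
  refine le_trans (le_of_eq (Finset.sum_congr rfl fun i _ => ?_)) h
  rw [Real.mul_rpow (hw i) (hx i), Real.mul_rpow (hw i) (hy i)]
  have : w i ^ θ * w i ^ (1 - θ) = w i := by
    rw [← Real.rpow_add' (hw i) (by norm_num)]
    simp
  calc w i * (x i ^ θ * y i ^ (1 - θ))
      = (w i ^ θ * w i ^ (1 - θ)) * (x i ^ θ * y i ^ (1 - θ)) := by rw [this]
    _ = _ := by ring

end Holder

/-! ### Variational formulas for Schatten norms -/

section Variational

variable {n : Type*} [Fintype n] [DecidableEq n]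

lemma schatten_conjDiag {U : Matrix n n ℂ} (hU : star U * U = 1) (d : n → ℝ) (α : ℝ) :
    schatten α (conjDiag U d) = (∑ i, d i ^ α) ^ (1 / α) := by
  rw [schatten, mpow_conjDiag hU, trace_conjDiag hU]

/-- The reverse Hölder inequality `‖A‖_α ≤ Tr (T ^ ((α - 1) / α) * A)` for `α < 1`. -/
lemma schatten_le_trace_mpow_mul {A T : Matrix n n ℂ} (hA : A.PosDef) (hT : T.PosDef)
    (hT1 : T.trace.re ≤ 1) {α : ℝ} (h0 : 0 < α) (h1 : α < 1) :
    schatten α A ≤ (mpow T (-((1 - α) / α)) * A).trace.re := by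
  obtain ⟨V, hV, a, ha, rfl⟩ := exists_conjDiag hA
  obtain ⟨U, hU, t, ht, rfl⟩ := exists_conjDiag hT
  rw [trace_conjDiag hU] at hT1
  rw [schatten_conjDiag hV, mpow_conjDiag hU, trace_conjDiag_mul_conjDiag]
  set M := ∑ p : n × n, overlap U V p.1 p.2 * (t p.1 ^ (-((1 - α) / α)) * a p.2) with hM
  have hx : ∀ p : n × n, 0 ≤ t p.1 ^ (-((1 - α) / α)) * a p.2 := fun p =>
    mul_nonneg (Real.rpow_nonneg (ht _).le _) (ha _).le
  have hM0 : 0 ≤ M := Finset.sum_nonneg fun p _ => mul_nonneg (overlap_nonneg U V _ _) (hx p)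
  -- Ordinary Hölder with `θ = α`: in `x ^ α * y ^ (1 - α)` the powers of `t` cancel and leave `a ^
  -- α`, so the trace appears on the larger side.
  have h := sum_weight_mul_rpow_le (Finset.univ : Finset (n × n))
    (w := fun p => overlap U V p.1 p.2) (x := fun p => t p.1 ^ (-((1 - α) / α)) * a p.2)
    (y := fun p => t p.1) (fun p => overlap_nonneg U V _ _) hx (fun p => (ht _).le) h0 h1
  have e : ∀ p : n × n, (t p.1 ^ (-((1 - α) / α)) * a p.2) ^ α * t p.1 ^ (1 - α) =
      a p.2 ^ α := fun p => by
    rw [Real.mul_rpow (Real.rpow_nonneg (ht _).le _) (ha _).le, ← Real.rpow_mul (ht _).le,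
      mul_right_comm, ← Real.rpow_add (ht _)]
    have : -((1 - α) / α) * α + (1 - α) = 0 := by field_simp; ring
    rw [this, Real.rpow_zero, one_mul]
  simp only [e] at h
  rw [sum_overlap_mul_right hU hV (fun j => a j ^ α), sum_overlap_mul_left hU hV t, ← hM] at h
  have h2 : ∑ j, a j ^ α ≤ M ^ α :=
    h.trans (mul_le_of_le_one_right (Real.rpow_nonneg hM0 _)
      (Real.rpow_le_one (Finset.sum_nonneg fun i _ => (ht i).le) hT1 (sub_pos.2 h1).le))
  calc (∑ j, a j ^ α) ^ (1 / α) ≤ (M ^ α) ^ (1 / α) :=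
        Real.rpow_le_rpow (Finset.sum_nonneg fun j _ => Real.rpow_nonneg (ha j).le _) h2
          (one_div_pos.2 h0).le
    _ = M := by rw [← Real.rpow_mul hM0, mul_one_div_cancel h0.ne', Real.rpow_one]

/-- Hölder's inequality `Tr (T ^ ((α - 1) / α) * A) ≤ ‖A‖_α` for `1 < α`. -/
lemma trace_mpow_mul_le_schatten {A T : Matrix n n ℂ} (hA : A.PosDef) (hT : T.PosDef)
    (hT1 : T.trace.re ≤ 1) {α : ℝ} (h1 : 1 < α) :
    (mpow T (-((1 - α) / α)) * A).trace.re ≤ schatten α A := by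
  have h0 : 0 < α := one_pos.trans h1
  have hθ : 1 / α < 1 := by rwa [div_lt_one h0]
  obtain ⟨V, hV, a, ha, rfl⟩ := exists_conjDiag hA
  obtain ⟨U, hU, t, ht, rfl⟩ := exists_conjDiag hT
  rw [trace_conjDiag hU] at hT1
  rw [schatten_conjDiag hV, mpow_conjDiag hU, trace_conjDiag_mul_conjDiag]
  -- Here `θ = 1 / α`, and the trace is the smaller side.
  have h := sum_weight_mul_rpow_le (Finset.univ : Finset (n × n))
    (w := fun p => overlap U V p.1 p.2) (x := fun p => a p.2 ^ α) (y := fun p => t p.1)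
    (fun p => overlap_nonneg U V _ _) (fun p => Real.rpow_nonneg (ha _).le _)
    (fun p => (ht _).le) (one_div_pos.2 h0) hθ
  have e : ∀ p : n × n, (a p.2 ^ α) ^ (1 / α) * t p.1 ^ (1 - 1 / α) =
      t p.1 ^ (-((1 - α) / α)) * a p.2 := fun p => by
    have : 1 - 1 / α = -((1 - α) / α) := by field_simp; ring
    rw [← Real.rpow_mul (ha _).le, mul_one_div_cancel h0.ne', Real.rpow_one, mul_comm, this]
  simp only [e] at h
  rw [sum_overlap_mul_right hU hV (fun j => a j ^ α), sum_overlap_mul_left hU hV t] at h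
  exact h.trans (mul_le_of_le_one_right
    (Real.rpow_nonneg (Finset.sum_nonneg fun j _ => Real.rpow_nonneg (ha j).le _) _)
    (Real.rpow_le_one (Finset.sum_nonneg fun i _ => (ht i).le) hT1 (sub_pos.2 hθ).le))

/-- Equality in Hölder's inequality at `T = A ^ α / Tr (A ^ α)`. -/
lemma exists_trace_mpow_mul_eq_schatten {A : Matrix n n ℂ} (hA : A.PosDef) {α : ℝ}
    (h0 : 0 < α) :
    ∃ T : Matrix n n ℂ, T.PosDef ∧ T.trace.re ≤ 1 ∧
      (mpow T (-((1 - α) / α)) * A).trace.re = schatten α A := by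
  obtain ⟨V, hV, a, ha, rfl⟩ := exists_conjDiag hA
  set K := ∑ i, a i ^ α with hK
  -- The index supplies nonemptiness; on an empty type `K = 0`.
  have hKi : ∀ i : n, 0 < K := fun i =>
    Finset.sum_pos (fun j _ => Real.rpow_pos_of_pos (ha j) α) ⟨i, Finset.mem_univ i⟩
  have ht : ∀ i, 0 < a i ^ α / K := fun i => div_pos (Real.rpow_pos_of_pos (ha i) α) (hKi i)
  refine ⟨conjDiag V fun i => a i ^ α / K, posDef_conjDiag hV ht, ?_, ?_⟩
  · rw [trace_conjDiag hV, ← Finset.sum_div]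
    exact div_self_le_one K
  · rw [schatten_conjDiag hV, mpow_conjDiag hV, conjDiag_mul hV, trace_conjDiag hV, ← hK]
    rcases isEmpty_or_nonempty n with hn | ⟨⟨i₀⟩⟩
    · rw [hK]
      simp [h0.ne']
    have hKp := hKi i₀
    have e : ∀ i, (a i ^ α / K) ^ (-((1 - α) / α)) * a i = a i ^ α * K ^ ((1 - α) / α) := by
      intro i
      rw [Real.div_rpow (Real.rpow_nonneg (ha i).le _) hKp.le, ← Real.rpow_mul (ha i).le,
        Real.rpow_neg hKp.le, div_inv_eq_mul, mul_right_comm]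
      congr 1
      rw [← Real.rpow_add_one (ha i).ne']
      congr 1
      field_simp
      ring
    simp only [e]
    rw [← Finset.sum_mul, ← hK, mul_comm, ← Real.rpow_add_one hKp.ne']
    congr 1
    field_simp
    ring

open scoped Matrix.Norms.L2Operator in
lemma schattenTop_conjDiag {U : Matrix n n ℂ} (hU : star U * U = 1) (d : n → ℝ) :
    schattenTop (conjDiag U d) = ‖d‖ := by
  have hu : U ∈ unitary (Matrix n n ℂ) := ⟨hU, mul_eq_one_comm.mp hU⟩
  rw [schattenTop, ← cstar_norm_def, conjDiag,
    CStarRing.norm_mul_mem_unitary _ (Unitary.star_mem hu),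
    CStarRing.norm_mem_unitary_mul _ hu, l2_opNorm_diagonal]
  simp [Pi.norm_def, nnnorm]

lemma trace_mul_le_schattenTop {A T : Matrix n n ℂ} (hA : A.PosDef) (hT : T.PosDef)
    (hT1 : T.trace.re ≤ 1) : (T * A).trace.re ≤ schattenTop A := by
  obtain ⟨V, hV, a, ha, rfl⟩ := exists_conjDiag hA
  obtain ⟨U, hU, t, ht, rfl⟩ := exists_conjDiag hT
  rw [trace_conjDiag hU] at hT1
  rw [schattenTop_conjDiag hV, trace_conjDiag_mul_conjDiag]
  calc ∑ p : n × n, overlap U V p.1 p.2 * (t p.1 * a p.2)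
      ≤ ∑ p : n × n, overlap U V p.1 p.2 * (t p.1 * ‖a‖) :=
        Finset.sum_le_sum fun p _ => mul_le_mul_of_nonneg_left
          (mul_le_mul_of_nonneg_left ((le_abs_self _).trans (norm_le_pi_norm a p.2)) (ht _).le)
          (overlap_nonneg U V _ _)
    _ = (∑ i, t i) * ‖a‖ := by
        rw [sum_overlap_mul_left hU hV fun i => t i * ‖a‖, Finset.sum_mul]
    _ ≤ ‖a‖ := mul_le_of_le_one_left (norm_nonneg _) hT1

/-- The projection onto a top eigenvector would be optimal but is in general not positive definite;
it is perturbed by a small weight `ε` on every eigenvector. -/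
lemma exists_lt_trace_mul {A : Matrix n n ℂ} (hA : A.PosDef) {c : ℝ}
    (hc : c < schattenTop A) :
    ∃ T : Matrix n n ℂ, T.PosDef ∧ T.trace.re ≤ 1 ∧ c < (T * A).trace.re := by
  obtain ⟨V, hV, a, ha, rfl⟩ := exists_conjDiag hA
  rw [schattenTop_conjDiag hV] at hc
  rcases isEmpty_or_nonempty n with hn | hn
  · refine ⟨1, PosDef.one, by simp, ?_⟩
    rw [Subsingleton.elim a 0, norm_zero] at hc
    simpa using hc
  obtain ⟨i₀, hi₀⟩ : ∃ i, c < a i := by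
    by_contra! h
    have hc0 : 0 ≤ c := (ha hn.some).le.trans (h _)
    refine hc.not_ge ((pi_norm_le_iff_of_nonneg hc0).2 fun i => ?_)
    rw [Real.norm_of_nonneg (ha i).le]
    exact h i
  have hN : (0 : ℝ) < Fintype.card n := by exact_mod_cast Fintype.card_pos
  obtain ⟨ε, hε, hε1, hε2⟩ : ∃ ε : ℝ, 0 < ε ∧ 0 < 1 - Fintype.card n * ε ∧
      c < (1 - Fintype.card n * ε) * a i₀ := by
    have h1 : Filter.Tendsto (fun ε : ℝ => 1 - Fintype.card n * ε) (nhdsWithin 0 (Set.Ioi 0))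
        (nhds 1) := by
      have : Continuous fun ε : ℝ => 1 - Fintype.card n * ε := by fun_prop
      simpa using (this.tendsto 0).mono_left nhdsWithin_le_nhds
    have h2 := h1.mul_const (a i₀)
    rw [one_mul] at h2
    obtain ⟨ε, h⟩ := ((eventually_mem_nhdsWithin).and
      ((h1.eventually_const_lt one_pos).and (h2.eventually_const_lt hi₀))).exists
    exact ⟨ε, h⟩
  -- The mass not spent on the uniform `ε` goes to `i₀`, so the trace is exactly `1`.
  let t : n → ℝ := fun i => ε + if i = i₀ then 1 - Fintype.card n * ε else 0
  have ht : ∀ i, 0 < t i := fun i => by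
    dsimp only [t]
    split_ifs <;> linarith
  refine ⟨conjDiag V t, posDef_conjDiag hV ht, ?_, ?_⟩
  · rw [trace_conjDiag hV]
    simp [t, Finset.sum_add_distrib]
  · rw [conjDiag_mul hV, trace_conjDiag hV]
    calc c < (1 - Fintype.card n * ε) * a i₀ := hε2
      _ ≤ t i₀ * a i₀ := by
        refine mul_le_mul_of_nonneg_right ?_ (ha i₀).le
        simp only [t, if_true]
        linarith
      _ ≤ ∑ i, t i * a i := Finset.single_le_sum (f := fun i => t i * a i)
        (fun i _ => (mul_pos (ht i) (ha i)).le) (Finset.mem_univ i₀)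

end Variational

/-! ### Exchanging the order in the sandwich -/

section Sandwich

variable {n : Type*} [Fintype n] [DecidableEq n]

lemma posDef_mpow_mul_mul_mpow {X Y : Matrix n n ℂ} (hX : X.PosDef) (hY : Y.PosDef) (s : ℝ) :
    (mpow Y s * X * mpow Y s).PosDef := by
  have hR := posDef_mpow hY s
  have h := (hR.isUnit.posDef_star_right_conjugate_iff (x := X)).2 hX
  rwa [star_eq_conjTranspose, hR.1.eq] at h

/-- `X ^ (1 / 2) * Y ^ s * X ^ (1 / 2)` and `Y ^ (s / 2) * X * Y ^ (s / 2)` are `B * B⋆` and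
`B⋆ * B` for `B = X ^ (1 / 2) * Y ^ (s / 2)`. -/
lemma charpoly_sandwich {X Y : Matrix n n ℂ} (hX : X.PosDef) (hY : Y.PosDef) {s r : ℝ}
    (hs : s = r + r) :
    (mpow X (1 / 2) * mpow Y s * mpow X (1 / 2)).charpoly =
      (mpow Y r * X * mpow Y r).charpoly := by
  have h1 : mpow X (1 / 2) * mpow Y s * mpow X (1 / 2) =
      (mpow X (1 / 2) * mpow Y r) * (mpow Y r * mpow X (1 / 2)) := by
    rw [hs, ← mpow_mul_mpow hY]
    simp only [Matrix.mul_assoc]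
  have h2 : mpow Y r * X * mpow Y r =
      (mpow Y r * mpow X (1 / 2)) * (mpow X (1 / 2) * mpow Y r) := by
    conv_lhs => rw [← mpow_one hX, ← add_halves (1 : ℝ), ← mpow_mul_mpow hX]
    simp only [Matrix.mul_assoc]
  rw [h1, h2, charpoly_mul_comm]

lemma schatten_sandwich {X Y : Matrix n n ℂ} (hX : X.PosDef) (hY : Y.PosDef) {s r : ℝ}
    (hs : s = r + r) (α : ℝ) :
    schatten α (mpow X (1 / 2) * mpow Y s * mpow X (1 / 2)) =
      schatten α (mpow Y r * X * mpow Y r) := by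
  exact congrArg (· ^ (1 / α)) (trace_cfc_eq_of_charpoly_eq
    (posDef_mpow_mul_mul_mpow (posDef_mpow hY s) hX _).1
    (posDef_mpow_mul_mul_mpow hX hY r).1 (charpoly_sandwich hX hY hs) _)

/-- The operator norm is the sup norm of the eigenvalue family, which the characteristic polynomial
determines. -/
lemma schattenTop_le_of_charpoly_eq {A B : Matrix n n ℂ} (hA : A.PosDef) (hB : B.PosDef)
    (h : A.charpoly = B.charpoly) : schattenTop A ≤ schattenTop B := by
  have key : ∀ {C : Matrix n n ℂ} (hC : C.PosDef),
      schattenTop C = ‖hC.1.eigenvalues‖ := by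
    intro C hC
    have hC' : C = conjDiag hC.1.eigenvectorUnitary hC.1.eigenvalues := by
      conv_lhs => rw [hC.1.spectral_theorem, Unitary.conjStarAlgAut_apply]
      rfl
    conv_lhs => rw [hC']
    exact schattenTop_conjDiag (by simp) _
  rw [key hA, key hB, (hA.1.eigenvalues_eq_eigenvalues_iff hB.1).2 h]

lemma schattenTop_sandwich {X Y : Matrix n n ℂ} (hX : X.PosDef) (hY : Y.PosDef) {s r : ℝ}
    (hs : s = r + r) :
    schattenTop (mpow X (1 / 2) * mpow Y s * mpow X (1 / 2)) =
      schattenTop (mpow Y r * X * mpow Y r) := by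
  have hA := posDef_mpow_mul_mul_mpow (posDef_mpow hY s) hX (1 / 2)
  have hB := posDef_mpow_mul_mul_mpow hX hY r
  exact le_antisymm (schattenTop_le_of_charpoly_eq hA hB (charpoly_sandwich hX hY hs))
    (schattenTop_le_of_charpoly_eq hB hA (charpoly_sandwich hX hY hs).symm)

lemma optimizedDivergence_eq_of_isMax {f : ℝ → ℝ} {X Y : Matrix n n ℂ} {c : ℝ}
    (hle : ∀ T : Matrix n n ℂ, T.PosDef → T.trace.re ≤ 1 → divergenceAt f X Y T ≤ c)
    (hex : ∃ T : Matrix n n ℂ, T.PosDef ∧ T.trace.re ≤ 1 ∧ divergenceAt f X Y T = c) :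
    optimizedDivergence f X Y = (c : EReal) := by
  refine le_antisymm (iSup₂_le fun T hT => EReal.coe_le_coe_iff.2 (hle T hT.1 hT.2)) ?_
  obtain ⟨T, hT, hT1, h⟩ := hex
  rw [← h]
  exact le_iSup₂_of_le T ⟨hT, hT1⟩ le_rfl

end Sandwich

end OptimizedDivergence

open OptimizedDivergence in
theorem mainTheorem4 {n : Type*} [Fintype n] [DecidableEq n] (X Y : Matrix n n ℂ)
    (hX : X.PosDef) (hY : Y.PosDef) :
    (∀ α : ℝ, 1 / 2 ≤ α → α < 1 →
      OptimizedDivergence.optimizedDivergence (fun x : ℝ => -x ^ ((1 - α) / α)) X Y =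
        ((-OptimizedDivergence.schatten α
            (OptimizedDivergence.mpow Y ((1 - α) / (2 * α)) * X *
              OptimizedDivergence.mpow Y ((1 - α) / (2 * α))) : ℝ) : EReal)) ∧
    (∀ α : ℝ, 1 < α →
      OptimizedDivergence.optimizedDivergence (fun x : ℝ => x ^ ((1 - α) / α)) X Y =
        ((OptimizedDivergence.schatten α
            (OptimizedDivergence.mpow Y ((1 - α) / (2 * α)) * X *
              OptimizedDivergence.mpow Y ((1 - α) / (2 * α))) : ℝ) : EReal)) ∧
    OptimizedDivergence.optimizedDivergence (fun x : ℝ => x ^ (-1 : ℝ)) X Y =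
      ((OptimizedDivergence.schattenTop
          (OptimizedDivergence.mpow Y (-1 / 2) * X *
            OptimizedDivergence.mpow Y (-1 / 2)) : ℝ) : EReal) := by
  have hA : ∀ s : ℝ, (mpow X (1 / 2) * mpow Y s * mpow X (1 / 2)).PosDef := fun s =>
    posDef_mpow_mul_mul_mpow (posDef_mpow hY s) hX (1 / 2)
  have hs : ∀ α : ℝ, α ≠ 0 → (1 - α) / α = (1 - α) / (2 * α) + (1 - α) / (2 * α) := by
    intro α h0
    field_simp
    ring
  refine ⟨fun α h h1 => ?_, fun α h1 => ?_, ?_⟩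
  · have h0 : 0 < α := by linarith
    rw [← schatten_sandwich hX hY (hs α h0.ne')]
    refine optimizedDivergence_eq_of_isMax (fun T hT hT1 => ?_) ?_
    · rw [divergenceAt_neg, divergenceAt_rpow hX hY hT]
      exact neg_le_neg (schatten_le_trace_mpow_mul (hA _) hT hT1 h0 h1)
    · obtain ⟨T, hT, hT1, e⟩ := exists_trace_mpow_mul_eq_schatten (hA ((1 - α) / α)) h0
      exact ⟨T, hT, hT1, by rw [divergenceAt_neg, divergenceAt_rpow hX hY hT, e]⟩
  · have h0 : 0 < α := by linarith
    rw [← schatten_sandwich hX hY (hs α h0.ne')]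
    refine optimizedDivergence_eq_of_isMax (fun T hT hT1 => ?_) ?_
    · rw [divergenceAt_rpow hX hY hT]
      exact trace_mpow_mul_le_schatten (hA _) hT hT1 h1
    · obtain ⟨T, hT, hT1, e⟩ := exists_trace_mpow_mul_eq_schatten (hA ((1 - α) / α)) h0
      exact ⟨T, hT, hT1, by rw [divergenceAt_rpow hX hY hT, e]⟩
  · rw [← schattenTop_sandwich hX hY (s := -1) (by norm_num)]
    have e : ∀ T : Matrix n n ℂ, T.PosDef → divergenceAt (fun x : ℝ => x ^ (-1 : ℝ)) X Y T =
        (T * (mpow X (1 / 2) * mpow Y (-1) * mpow X (1 / 2))).trace.re := fun T hT => by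
      rw [divergenceAt_rpow hX hY hT, neg_neg, mpow_one hT]
    refine le_antisymm (iSup₂_le fun T hT => EReal.coe_le_coe_iff.2 ?_) ?_
    · rw [e T hT.1]
      exact trace_mul_le_schattenTop (hA _) hT.1 hT.2
    -- The supremum need not be attained, so every real below the norm is shown to be exceeded.
    · refine EReal.ge_of_forall_gt_iff_ge.1 fun c hc => ?_
      obtain ⟨T, hT, hT1, h⟩ := exists_lt_trace_mul (hA (-1)) (EReal.coe_lt_coe_iff.1 hc)
      refine le_iSup₂_of_le T ⟨hT, hT1⟩ ?_
      rw [e T hT]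
      exact EReal.coe_le_coe_iff.2 h.le
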